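/- Let $f:\mathbb{R}^n\to\mathbb{R}$ and $g:\mathbb{R}^n\to\mathbb{R}^m$ be twice continuously differentiable, let $K\subseteq\mathbb{R}^m$ be closed, and consider the problem $\min f(x)$ subject to $g(x)\in K$, with feasible set $C:=g^{-1}(K)$ and Lagrangian $L(x,\lambda):=f(x)+\langle\lambda,g(x)\rangle$. **Definitions.** Below, $t_k\downarrow0$ means $t_k>0$ and $t_k\to0$. For a set $S$ in a Euclidean space, a point $x$ and a direction $d$: - $T_S(x)$ is the set of all $d$ for which there are $t_k\downarrow0$, $d_k\to d$ with $x+t_kd_k\in S$ for all $k$. - $T_S^2(x;d)$ is the set of all $w$ for which there are $t_k\downarrow0$, $w_k\to w$ with $x+t_kd+\frac12t_k^2w_k\in S$ for all $k$. - $T_S''(x;d)$ is the set of all $w$ for which there are $t_k\downarrow0$, $r_k\downarrow0$ with $t_k/r_k\to0$ and $w_k\to w$ such that $x+t_kd+\frac12t_kr_kw_k\in S$ for all $k$. - For $x\in S$, $\hat N_S(x):=\{v\mid \limsup_{y\to x,\,y\in S\setminus\{x\}}\langle v,y-x\rangle/\|y-x\|\le0\}$ (the whole space if $x$ is isolated in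 $S$), and $N_S(x)$ is the set of all limits of sequences $v_k\in\hat N_S(x_k)$ with $x_k\to x$, $x_k\in S$; for $x\notin S$ both sets are empty. $N_S(x;d)$ is the set of all limits of sequences $v_k\in\hat N_S(x+t_kd_k)$ with $t_k\downarrow0$, $d_k\to d$. - $\sigma_S(\lambda):=\sup_{u\in S}\langle\lambda,u\rangle\in[-\infty,+\infty]$. - For $S\neq\emptyset$ closed and any set $A$, $$\hat\sigma_{S,A}(\lambda):=\liminf_{\lambda'\to\lambda}\ \inf\{\langle\lambda',u\rangle\mid u\in A,\ \lambda'\in N_S(u)\},$$ where $\lambda'=\lambda$ is allowed in the lower limit and $\inf\emptyset=+\infty$; $\hat\sigma_{\emptyset,A}:=-\infty$; and $\hat\sigma_S:=\hat\sigma_{S,A}$ with $A$ the whole space. - For $\rho,\delta>0$, $V_{\rho,\delta}(d):=\{w\mid\|w\|\le\delta,\ \big\|\|d\|w-\|w\|d\big\|\le\rho\|w\|\|d\|\}$. A point $\bar x\in C$ is a local optimal solution in direction $d$ if there are $\rho,\delta>0$ with $f(x)\ge f(\bar x)$ for all $x\in C\cap(\bar x+V_{\rho,\delta}(d))$. The metric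 subregularity constraint qualification (MSCQ) holds at $\bar x$ in direction $d$ if there are $\rho,\delta,\kappa>0$ with $\operatorname{dist}(x,C)\le\kappa\operatorname{dist}(g(x),K)$ for all $x\in\bar x+V_{\rho,\delta}(d)$. Put $$\Lambda(\bar x;d):=\{\lambda\in\mathbb{R}^m\mid\lambda\in N_K(g(\bar x);\nabla g(\bar x)d),\ \nabla_xL(\bar x,\lambda)=0\},$$ $$\Theta:=\nabla g(\bar x)\big(T_C''(\bar x;d)\big),\qquad \Omega:=\nabla g(\bar x)\big(T_C^2(\bar x;d)\big)+\nabla^2g(\bar x)(d,d),$$ $$T_K'':=T_K''(g(\bar x);\nabla g(\bar x)d),\qquad T_K^2:=T_K^2(g(\bar x);\nabla g(\bar x)d).$$ **Proposition.** Let $\bar x\in C$ be a local optimal solution in direction $d$, where $d\in T_C(\bar x)$ and $\nabla f(\bar x)d=0$, and suppose that MSCQ holds at $\bar x$ in direction $d$. Then: (i) There exists $\lambda\in\Lambda(\bar x;d)$ such that for every $A\subseteq\mathbb{R}^m$ with $A\supseteq\Theta$, $$\hat\sigma_{T_K''}(\lambda)\le\hat\sigma_{T_K'',A}(\lambda)\le\sigma_\Theta(\lambda).$$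 (ii) If $T_K^2\neq\emptyset$, there exists $\lambda\in\Lambda(\bar x;d)$ such that for every $B\subseteq\mathbb{R}^m$ with $B\supseteq\Omega$, $$\hat\sigma_{T_K^2}(\lambda)\le\hat\sigma_{T_K^2,B}(\lambda)\le\sigma_\Omega(\lambda).$$ -/

import Mathlib

open Filter Topology

noncomputable section

namespace DirOpt

section Geometry

variable {E : Type*} [NormedAddCommGroup E] [InnerProductSpace ℝ E]

/-- The Bouligand (contingent) tangent cone `T_S(x)`: all limits `d` of sequences `d_k` with
`x + t_k d_k ∈ S` for some `t_k ↓ 0`. -/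
def tangentCone (S : Set E) (x : E) : Set E :=
  {d | ∃ (t : ℕ → ℝ) (d' : ℕ → E), (∀ k, 0 < t k) ∧ Tendsto t atTop (𝓝 0) ∧
    Tendsto d' atTop (𝓝 d) ∧ ∀ k, x + t k • d' k ∈ S}

/-- The outer second-order tangent set `T_S²(x; d)`. -/
def secondTangentSet (S : Set E) (x d : E) : Set E :=
  {w | ∃ (t : ℕ → ℝ) (w' : ℕ → E), (∀ k, 0 < t k) ∧ Tendsto t atTop (𝓝 0) ∧
    Tendsto w' atTop (𝓝 w) ∧ ∀ k, x + t k • d + ((1 / 2 : ℝ) * t k ^ 2) • w' k ∈ S}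

/-- The asymptotic second-order tangent cone `T_S''(x; d)`. -/
def asymptoticTangentCone (S : Set E) (x d : E) : Set E :=
  {w | ∃ (t r : ℕ → ℝ) (w' : ℕ → E), (∀ k, 0 < t k) ∧ (∀ k, 0 < r k) ∧
    Tendsto t atTop (𝓝 0) ∧ Tendsto r atTop (𝓝 0) ∧
    Tendsto (fun k => t k / r k) atTop (𝓝 0) ∧ Tendsto w' atTop (𝓝 w) ∧
    ∀ k, x + t k • d + ((1 / 2 : ℝ) * t k * r k) • w' k ∈ S}

/-- The Fréchet normal cone: `v` such that `limsup ⟪v, y - x⟫ / ‖y - x‖ ≤ 0` as `y → x` in `S`.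
It is empty at points outside `S`. -/
def frechetNormalCone (S : Set E) (x : E) : Set E :=
  {v | x ∈ S ∧ ∀ ε : ℝ, 0 < ε → ∀ᶠ y in 𝓝[S] x, inner ℝ v (y - x) ≤ ε * ‖y - x‖}

/-- The limiting (Mordukhovich) normal cone `N_S(x)`; it is empty at points outside `S`. -/
def limitingNormalCone (S : Set E) (x : E) : Set E :=
  {v | x ∈ S ∧ ∃ x' v' : ℕ → E, Tendsto x' atTop (𝓝 x) ∧ Tendsto v' atTop (𝓝 v) ∧
    ∀ k, v' k ∈ frechetNormalCone S (x' k)}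

/-- The limiting normal cone `N_S(x; d)` to `S` at `x` in direction `d`. -/
def directionalNormalCone (S : Set E) (x d : E) : Set E :=
  {v | ∃ (t : ℕ → ℝ) (d' v' : ℕ → E), (∀ k, 0 < t k) ∧ Tendsto t atTop (𝓝 0) ∧
    Tendsto d' atTop (𝓝 d) ∧ Tendsto v' atTop (𝓝 v) ∧
    ∀ k, v' k ∈ frechetNormalCone S (x + t k • d' k)}

/-- The directional neighbourhood `V_{ρ,δ}(d)` (a neighbourhood of the origin in direction `d`). -/
def directionalNhd (ρ δ : ℝ) (d : E) : Set E :=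
  {w | ‖w‖ ≤ δ ∧ ‖‖d‖ • w - ‖w‖ • d‖ ≤ ρ * ‖w‖ * ‖d‖}

/-- The support function `σ_S(l) = sup {⟪l, u⟫ | u ∈ S}`, with value `-∞` for `S = ∅`. -/
def supportFun (S : Set E) (l : E) : EReal :=
  ⨆ u ∈ S, ((inner ℝ l u : ℝ) : EReal)

open Classical in
/-- The lower generalized support function `σ̂_{S,A}(l)` to `S` with respect to `A`:
the lower limit, as `l' → l` (with `l' = l` allowed), of
`inf {⟪l', u⟫ | l' ∈ N_S(u), u ∈ A}`; it is `-∞` for `S = ∅`. -/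
def lowerSupportFunOn (S A : Set E) (l : E) : EReal :=
  if S = ∅ then ⊥
  else liminf (fun l' : E =>
    ⨅ u ∈ {u : E | l' ∈ limitingNormalCone S u} ∩ A, ((inner ℝ l' u : ℝ) : EReal)) (𝓝 l)

/-- The lower generalized support function `σ̂_S`, i.e. `σ̂_{S,A}` with `A` the whole space. -/
def lowerSupportFun (S : Set E) (l : E) : EReal :=
  lowerSupportFunOn S Set.univ l

end Geometry

section Problem

variable {E F : Type*} [NormedAddCommGroup E] [InnerProductSpace ℝ E]
  [NormedAddCommGroup F] [InnerProductSpace ℝ F]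

/-- `x ∈ C` is a local minimizer of `f` over `C` in direction `d`. -/
def IsLocalSolutionInDirection (f : E → ℝ) (C : Set E) (x d : E) : Prop :=
  x ∈ C ∧ ∃ ρ δ : ℝ, 0 < ρ ∧ 0 < δ ∧
    ∀ w ∈ directionalNhd ρ δ d, x + w ∈ C → f x ≤ f (x + w)

/-- Metric subregularity of the set-valued map `M` at `(x, y)` in direction `d`. -/
def MetricallySubregularInDirection (M : E → Set F) (x : E) (y : F) (d : E) : Prop :=
  ∃ ρ δ κ : ℝ, 0 < ρ ∧ 0 < δ ∧ 0 < κ ∧ ∀ w ∈ directionalNhd ρ δ d,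
    Metric.infEDist (x + w) {z | y ∈ M z} ≤ ENNReal.ofReal κ * Metric.infEDist y (M (x + w))

/-- The metric subregularity constraint qualification at `x` in direction `d` for `g(x) ∈ K`:
directional metric subregularity of `x ↦ g(x) - K` at `(x, 0)`. -/
def MSCQInDirection (g : E → F) (K : Set F) (x d : E) : Prop :=
  MetricallySubregularInDirection (fun z => (fun y => g z - y) '' K) x 0 d

/-- The Lagrangian `L(x, l) = f(x) + ⟪l, g(x)⟫`. -/
def lagrangian (f : E → ℝ) (g : E → F) (x : E) (l : F) : ℝ :=
  f x + inner ℝ l (g x)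

/-- The set `Λ(x; d)` of M-multipliers in direction `d`. -/
def multiplierSet (f : E → ℝ) (g : E → F) (K : Set F) (x d : E) : Set F :=
  {l | l ∈ directionalNormalCone K (g x) (fderiv ℝ g x d) ∧
    fderiv ℝ (fun z => lagrangian f g z l) x = 0}

/-- `Θ = ∇g(x) (T_C''(x; d))` with `C = g⁻¹(K)`. -/
def thetaSet (g : E → F) (K : Set F) (x d : E) : Set F :=
  (fun w => fderiv ℝ g x w) '' asymptoticTangentCone (g ⁻¹' K) x d

/-- `Ω = ∇g(x) (T_C²(x; d)) + ∇²g(x)(d, d)` with `C = g⁻¹(K)`. -/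
def omegaSet (g : E → F) (K : Set F) (x d : E) : Set F :=
  (fun w => fderiv ℝ g x w + fderiv ℝ (fderiv ℝ g) x d d) '' secondTangentSet (g ⁻¹' K) x d

end Problem

end DirOpt

end

/-! Both second-order tangent sets are instances of one set, `scaledTangentSet τ`: perturbations `t
d + s w` with `s = o(t)` and `t² / (2 s) → τ`, where `τ = 0` gives `T''` and `τ = 1` gives `T²`.
Write `A = ∇g(x)`, `b = τ ∇²g(x)(d,d)` and `T` for the scaled tangent set of `K`. Taylor expansion
together with MSCQ shows that the scaled tangent set of `C` is `{w | A w + b ∈ T}`, with a global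
error bound inherited from MSCQ (`MSCQInDirection.exists_mem_scaledTangentSet`). Local optimality
bounds `∇f(x) w` from below on this set.

This leaves a linear program over a closed, generally nonconvex set, whose infimum need not be
attained. Adding `ε_k ‖w‖²` gives minimizers `w_k`, and a quadratic penalty gives multipliers `l_k`
at `w_k`. The error bound keeps the `l_k` bounded even when `w_k` escapes to infinity, and a cluster
point `l` is stationary for the original program. Comparing the two stationarity equations at `w_k`
gives `⟪l_k, A w_k⟫ ≤ ⟪l, A w_k⟫`, which bounds the lower generalized support function by the
support function (`exists_multiplier_lowerSupportFunOn_le`). Finally, `l` is a directional normal to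
`K` because proximal normals to `T` are (`proximalNormalCone_scaledTangentSet_subset`). -/

namespace DirOpt

/-! ### Second-order Taylor expansion. -/

section Taylor

variable {E F : Type*} [NormedAddCommGroup E] [NormedSpace ℝ E]
  [NormedAddCommGroup F] [NormedSpace ℝ F]

/-- Second-order Taylor expansion with Peano remainder. -/
theorem isLittleO_taylor_two {g : E → F} (hg : ContDiff ℝ 2 g) (x : E) :
    (fun h => g (x + h) - g x - fderiv ℝ g x h - (1 / 2 : ℝ) • fderiv ℝ (fderiv ℝ g) x h h)
      =o[𝓝 0] fun h => ‖h‖ ^ 2 := by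
  have hsymm : ∀ u v, fderiv ℝ (fderiv ℝ g) x u v = fderiv ℝ (fderiv ℝ g) x v u := fun u v =>
    (hg.contDiffAt (x := x)).isSymmSndFDerivAt (by simp) u v
  have hdiff : Differentiable ℝ g := hg.differentiable (by norm_num)
  have hd2 : HasFDerivAt (fderiv ℝ g) (fderiv ℝ (fderiv ℝ g) x) x :=
    ((hg.fderiv_right (m := 1) (by norm_num)).differentiable (by norm_num) x).hasFDerivAt
  set φ : E → F := fun h =>
    g (x + h) - g x - fderiv ℝ g x h - (1 / 2 : ℝ) • fderiv ℝ (fderiv ℝ g) x h h with hφ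
  have hderiv : ∀ h, HasFDerivAt φ
      (fderiv ℝ g (x + h) - fderiv ℝ g x - fderiv ℝ (fderiv ℝ g) x h) h := by
    intro h
    have h1 : HasFDerivAt (fun h => g (x + h)) (fderiv ℝ g (x + h)) h := by
      have := (hdiff (x + h)).hasFDerivAt
      exact (hasFDerivAt_comp_add_left x).2 this
    have h2 : HasFDerivAt (fun h => fderiv ℝ g x h) (fderiv ℝ g x) h :=
      (fderiv ℝ g x).hasFDerivAt
    have h3 := ((fderiv ℝ (fderiv ℝ g) x).hasFDerivAt (x := h)).clm_apply (hasFDerivAt_id h)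
    have h4 := ((h1.sub_const (g x)).sub h2).sub (h3.const_smul (1 / 2 : ℝ))
    refine h4.congr_fderiv ?_
    ext v
    simp [hsymm v h, ← two_smul ℝ, smul_smul]
  have hφ0 : φ 0 = 0 := by simp [hφ]
  refine Asymptotics.isLittleO_iff.2 fun c hc => ?_
  have hd2' := (hasFDerivAt_iff_isLittleO_nhds_zero.1 hd2)
  obtain ⟨δ, hδ, hball⟩ := Metric.eventually_nhds_iff_ball.1 (Asymptotics.isLittleO_iff.1 hd2' hc)
  refine Metric.eventually_nhds_iff_ball.2 ⟨δ, hδ, fun h hh => ?_⟩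
  have hh' : ‖h‖ < δ := by simpa using hh
  -- Mean value inequality on the ball of radius `‖h‖`, where the derivative of `φ` is at most `c *
  -- ‖h‖`.
  have := (convex_closedBall (0 : E) ‖h‖).norm_image_sub_le_of_norm_hasFDerivWithin_le
    (f := φ) (C := c * ‖h‖) (x := 0) (y := h)
    (fun y _ => (hderiv y).hasFDerivWithinAt) (fun y hy => ?_) (by simp) (by simp)
  · rw [hφ0] at this
    simp only [sub_zero] at this
    calc ‖φ h‖ ≤ c * ‖h‖ * ‖h‖ := this
      _ = c * ‖‖h‖ ^ 2‖ := by simp; ring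
  · have hy' : ‖y‖ ≤ ‖h‖ := by simpa using hy
    exact (hball y (by simpa using hy'.trans_lt hh')).trans (by gcongr)

/-- Expansion of a `C²` map along `x + t d + s w` with `s = o(t)` and `t² / (2 s) → τ`. -/
theorem tendsto_taylor_two {g : E → F} (hg : ContDiff ℝ 2 g) {x d w : E} {τ : ℝ}
    {t s : ℕ → ℝ} {w' : ℕ → E} (ht : ∀ k, 0 < t k) (hs : ∀ k, 0 < s k)
    (ht0 : Tendsto t atTop (𝓝 0)) (hst : Tendsto (fun k => s k / t k) atTop (𝓝 0))
    (hτ : Tendsto (fun k => t k ^ 2 / (2 * s k)) atTop (𝓝 τ)) (hw : Tendsto w' atTop (𝓝 w)) :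
    Tendsto (fun k => (s k)⁻¹ • (g (x + (t k • d + s k • w' k)) - g x - t k • fderiv ℝ g x d))
      atTop (𝓝 (fderiv ℝ g x w + τ • fderiv ℝ (fderiv ℝ g) x d d)) := by
  set d' : ℕ → E := fun k => d + (s k / t k) • w' k with hd'
  have hdlim : Tendsto d' atTop (𝓝 d) := by simpa using (hst.smul hw).const_add d
  have hh : ∀ k, t k • d + s k • w' k = t k • d' k := fun k => by
    simp [hd', smul_smul, mul_div_cancel₀ _ (ht k).ne']
  have hh0 : Tendsto (fun k => t k • d' k) atTop (𝓝 0) := by simpa using ht0.smul hdlim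
  have hO := (isLittleO_taylor_two hg x).comp_tendsto hh0
  set R : ℕ → F := fun k => g (x + t k • d' k) - g x - fderiv ℝ g x (t k • d' k) -
    (1 / 2 : ℝ) • fderiv ℝ (fderiv ℝ g) x (t k • d' k) (t k • d' k) with hR
  -- The Taylor remainder is `o(t²)`, hence `o(s)` because `t² / (2 s)` converges.
  have hO2 : R =o[atTop] fun k => s k := by
    refine hO.trans_isBigO ?_
    have hb : Tendsto (fun k => t k ^ 2 / (2 * s k) * (2 * ‖d' k‖ ^ 2)) atTop
        (𝓝 (τ * (2 * ‖d‖ ^ 2))) := hτ.mul ((hdlim.norm.pow 2).const_mul 2)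
    refine (hb.isBigO_one ℝ |>.mul (Asymptotics.isBigO_refl s atTop)).congr (fun k => ?_)
      (fun k => one_mul _)
    have := (hs k).ne'
    simp only [Function.comp, norm_smul, Real.norm_eq_abs, mul_pow, sq_abs]
    field_simp
  have hR0 : Tendsto (fun k => (s k)⁻¹ • R k) atTop (𝓝 0) := by
    refine tendsto_zero_iff_norm_tendsto_zero.2 (hO2.norm_left.tendsto_div_nhds_zero.congr
      fun k => ?_)
    rw [norm_smul, Real.norm_eq_abs, abs_of_pos (inv_pos.2 (hs k)), div_eq_inv_mul]
  have hlim : Tendsto (fun k => fderiv ℝ g x (w' k) + (t k ^ 2 / (2 * s k)) •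
      fderiv ℝ (fderiv ℝ g) x (d' k) (d' k) + (s k)⁻¹ • R k) atTop
      (𝓝 (fderiv ℝ g x w + τ • fderiv ℝ (fderiv ℝ g) x d d + 0)) := by
    refine ((((fderiv ℝ g x).continuous.tendsto w).comp hw).add (hτ.smul ?_)).add hR0
    have hc : Continuous fun h => fderiv ℝ (fderiv ℝ g) x h h := by fun_prop
    exact (hc.tendsto d).comp hdlim
  rw [add_zero] at hlim
  refine hlim.congr fun k => ?_
  have h1 := (hs k).ne'
  have h2 : fderiv ℝ g x (t k • d' k) = t k • fderiv ℝ g x d + s k • fderiv ℝ g x (w' k) := by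
    rw [← hh k]; simp
  rw [hh k]
  simp only [hR, h2]
  simp only [map_smul, smul_apply]
  match_scalars <;> field_simp <;> ring

end Taylor

/-! ### A common form for both second-order tangent sets. -/

section ScaledTangentSet

variable {E : Type*} [NormedAddCommGroup E]

/-- Limits `w` of `w_k` with `x + t_k d + s_k w_k ∈ S`, where `t_k ↓ 0`, `s_k > 0`,
`s_k / t_k → 0` and `t_k² / (2 s_k) → τ`. -/
def scaledTangentSet [NormedSpace ℝ E] (τ : ℝ) (S : Set E) (x d : E) : Set E :=
  {w | ∀ ε : ℝ, 0 < ε → ∃ (t s : ℝ) (w' : E), 0 < t ∧ t < ε ∧ 0 < s ∧ s / t < ε ∧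
    |t ^ 2 / (2 * s) - τ| < ε ∧ dist w' w < ε ∧ x + (t • d + s • w') ∈ S}

variable [InnerProductSpace ℝ E] {τ : ℝ} {S : Set E} {x d w : E}

theorem tendsto_of_dist_lt_one_div {X : Type*} [PseudoMetricSpace X] {u : ℕ → X} {a : X}
    (h : ∀ k, dist (u k) a < 1 / ((k : ℝ) + 1)) : Tendsto u atTop (𝓝 a) :=
  tendsto_iff_dist_tendsto_zero.2 <| squeeze_zero (fun _ => dist_nonneg) (fun k => (h k).le)
    tendsto_one_div_add_atTop_nhds_zero_nat

/-- The `ε`-form makes closedness an `ε / 2` argument without diagonal sequences; the sequential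
form serves the limit arguments. -/
theorem mem_scaledTangentSet_iff : w ∈ scaledTangentSet τ S x d ↔
    ∃ (t s : ℕ → ℝ) (w' : ℕ → E), (∀ k, 0 < t k) ∧ (∀ k, 0 < s k) ∧ Tendsto t atTop (𝓝 0) ∧
      Tendsto (fun k => s k / t k) atTop (𝓝 0) ∧
      Tendsto (fun k => t k ^ 2 / (2 * s k)) atTop (𝓝 τ) ∧ Tendsto w' atTop (𝓝 w) ∧
      ∀ k, x + (t k • d + s k • w' k) ∈ S := by
  constructor
  · intro h
    choose t s w' h1 h2 h3 h4 h5 h6 h7 using fun k : ℕ =>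
      h (1 / ((k : ℝ) + 1)) Nat.one_div_pos_of_nat
    refine ⟨t, s, w', h1, h3, ?_, ?_, ?_, tendsto_of_dist_lt_one_div h6, h7⟩
    · exact tendsto_of_dist_lt_one_div fun k => by simpa [abs_of_pos (h1 k)] using h2 k
    · refine tendsto_of_dist_lt_one_div fun k => ?_
      rw [Real.dist_eq, sub_zero, abs_of_pos (div_pos (h3 k) (h1 k))]
      exact h4 k
    · exact tendsto_of_dist_lt_one_div fun k => by simpa [Real.dist_eq] using h5 k
  · rintro ⟨t, s, w', h1, h2, h3, h4, h5, h6, h7⟩ ε hε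
    obtain ⟨k, ⟨⟨hk1, hk2⟩, hk3⟩, hk4⟩ := (((h3.eventually_lt_const hε).and
      (h4.eventually_lt_const hε)).and ((Metric.tendsto_nhds.1 h5) ε hε)).and
      ((Metric.tendsto_nhds.1 h6) ε hε) |>.exists
    exact ⟨t k, s k, w' k, h1 k, hk1, h2 k, hk2, by rwa [Real.dist_eq] at hk3, hk4, h7 k⟩

theorem isClosed_scaledTangentSet : IsClosed (scaledTangentSet τ S x d) := by
  refine isClosed_of_closure_subset fun w hw ε hε => ?_
  obtain ⟨v, hv, hvw⟩ := Metric.mem_closure_iff.1 hw (ε / 2) (half_pos hε)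
  obtain ⟨t, s, w', h1, h2, h3, h4, h5, h6, h7⟩ := hv (ε / 2) (half_pos hε)
  refine ⟨t, s, w', h1, by linarith, h3, by linarith, by linarith, ?_, h7⟩
  have := dist_triangle w' v w
  rw [dist_comm v w] at this
  linarith

/-- Take `s = t r / 2`: then `s / t = r / 2` and `t² / (2 s) = t / r`. -/
theorem asymptoticTangentCone_eq :
    asymptoticTangentCone S x d = scaledTangentSet 0 S x d := by
  ext w
  rw [mem_scaledTangentSet_iff]
  constructor
  · rintro ⟨t, r, w', h1, h2, h3, h4, h5, h6, h7⟩
    refine ⟨t, fun k => 1 / 2 * t k * r k, w', h1,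
      fun k => mul_pos (mul_pos (by norm_num) (h1 k)) (h2 k), h3, ?_, ?_, h6, ?_⟩
    · have := h4.const_mul (1 / 2)
      rw [mul_zero] at this
      refine this.congr fun k => ?_
      have := (h1 k).ne'
      field_simp
    · refine h5.congr fun k => ?_
      have := (h1 k).ne'
      have := (h2 k).ne'
      field_simp
    · intro k
      rw [← add_assoc]
      exact h7 k
  · rintro ⟨t, s, w', h1, h2, h3, h4, h5, h6, h7⟩
    refine ⟨t, fun k => 2 * (s k / t k), w', h1,
      fun k => mul_pos two_pos (div_pos (h2 k) (h1 k)), h3, by simpa using h4.const_mul 2,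
      h5.congr fun k => ?_, h6, fun k => ?_⟩
    · have := (h1 k).ne'
      have := (h2 k).ne'
      field_simp
    · convert h7 k using 1
      rw [← add_assoc]
      congr 2
      have := (h1 k).ne'
      field_simp

/-- Since `t² / (2 s) → 1`, a general scale `s` can be replaced by `t² / 2`, the ratio being
absorbed into `w'`. -/
theorem secondTangentSet_eq : secondTangentSet S x d = scaledTangentSet 1 S x d := by
  ext w
  rw [mem_scaledTangentSet_iff]
  constructor
  · rintro ⟨t, w', h1, h3, h6, h7⟩
    refine ⟨t, fun k => 1 / 2 * t k ^ 2, w', h1,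
      fun k => mul_pos (by norm_num) (pow_pos (h1 k) 2), h3, ?_, ?_, h6, ?_⟩
    · have := h3.const_mul (1 / 2)
      rw [mul_zero] at this
      refine this.congr fun k => ?_
      have := (h1 k).ne'
      field_simp
    · refine tendsto_const_nhds.congr fun k => ?_
      have := (h1 k).ne'
      field_simp
    · intro k
      rw [← add_assoc]
      exact h7 k
  · rintro ⟨t, s, w', h1, h2, h3, h4, h5, h6, h7⟩
    refine ⟨t, fun k => (t k ^ 2 / (2 * s k))⁻¹ • w' k, h1, h3, ?_, fun k => ?_⟩
    · simpa using (h5.inv₀ one_ne_zero).smul h6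
    · convert h7 k using 1
      rw [← add_assoc, smul_smul]
      congr 2
      have := (h1 k).ne'
      have := (h2 k).ne'
      field_simp

theorem mem_scaledTangentSet_of_subseq {t s : ℕ → ℝ} {w' : ℕ → E} {φ : ℕ → ℕ}
    (hφ : StrictMono φ) (h1 : ∀ᶠ k in atTop, 0 < t k) (h2 : ∀ᶠ k in atTop, 0 < s k)
    (h3 : Tendsto t atTop (𝓝 0))
    (h4 : Tendsto (fun k => s k / t k) atTop (𝓝 0))
    (h5 : Tendsto (fun k => t k ^ 2 / (2 * s k)) atTop (𝓝 τ))
    (h6 : Tendsto (w' ∘ φ) atTop (𝓝 w)) (h7 : ∀ᶠ k in atTop, x + (t k • d + s k • w' k) ∈ S) :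
    w ∈ scaledTangentSet τ S x d := by
  intro ε hε
  obtain ⟨k, ⟨⟨hk1, hk2⟩, ⟨hk3, hk5⟩, hk6, hk7⟩, hk4⟩ :=
    (hφ.tendsto_atTop.eventually (((h3.eventually_lt_const hε).and
      (h4.eventually_lt_const hε)).and (((Metric.tendsto_nhds.1 h5 ε hε).and h1).and
      (h2.and h7)))).and ((Metric.tendsto_nhds.1 h6) ε hε) |>.exists
  exact ⟨t (φ k), s (φ k), w' (φ k), hk5, hk1, hk6, hk2, by rwa [Real.dist_eq] at hk3, hk4, hk7⟩

theorem tendsto_direction {t s : ℕ → ℝ} {w' : ℕ → E}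
    (hst : Tendsto (fun k => s k / t k) atTop (𝓝 0)) (hw : Tendsto w' atTop (𝓝 w)) :
    Tendsto (fun k => d + (s k / t k) • w' k) atTop (𝓝 d) := by
  simpa using (hst.smul hw).const_add d

theorem smul_direction {t s : ℝ} (ht : 0 < t) (w : E) :
    t • (d + (s / t) • w) = t • d + s • w := by
  rw [smul_add, smul_smul, mul_div_cancel₀ _ ht.ne']

/-- After factoring out `t`, the perturbation is `t d'` with `d' → d`, and the angular condition is
homogeneous, so it need only be checked for `d'`. -/
theorem eventually_mem_directionalNhd {ρ δ : ℝ} (hρ : 0 < ρ) (hδ : 0 < δ) {t s : ℕ → ℝ}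
    {w' : ℕ → E} (ht : ∀ k, 0 < t k) (ht0 : Tendsto t atTop (𝓝 0))
    (hst : Tendsto (fun k => s k / t k) atTop (𝓝 0)) (hw : Tendsto w' atTop (𝓝 w)) :
    ∀ᶠ k in atTop, t k • d + s k • w' k ∈ directionalNhd ρ δ d := by
  have hdl := tendsto_direction (d := d) hst hw
  set d' := fun k => d + (s k / t k) • w' k with hd'
  have h0 : Tendsto (fun k => ‖t k • d' k‖) atTop (𝓝 0) := by
    simpa using (ht0.smul hdl).norm
  have hdir : ∀ᶠ k in atTop, ‖‖d‖ • d' k - ‖d' k‖ • d‖ ≤ ρ * ‖d' k‖ * ‖d‖ := by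
    rcases eq_or_ne d 0 with rfl | hd0
    · simp
    · have hl : Tendsto (fun k => ‖‖d‖ • d' k - ‖d' k‖ • d‖) atTop (𝓝 0) := by
        simpa using ((hdl.const_smul ‖d‖).sub (hdl.norm.smul_const d)).norm
      have hr : Tendsto (fun k => ρ * ‖d' k‖ * ‖d‖) atTop (𝓝 (ρ * ‖d‖ * ‖d‖)) :=
        (hdl.norm.const_mul ρ).mul_const _
      have : 0 < ‖d‖ := norm_pos_iff.2 hd0
      exact (hl.eventually_lt hr (by positivity)).mono fun k hk => hk.le
  filter_upwards [h0.eventually_lt_const hδ, hdir] with k h1 h2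
  rw [← smul_direction (ht k)]
  refine ⟨h1.le, ?_⟩
  have e : ‖d‖ • t k • d' k - ‖t k • d' k‖ • d = t k • (‖d‖ • d' k - ‖d' k‖ • d) := by
    rw [norm_smul, Real.norm_eq_abs, abs_of_pos (ht k)]
    module
  change ‖‖d‖ • t k • d' k - ‖t k • d' k‖ • d‖ ≤ ρ * ‖t k • d' k‖ * ‖d‖
  rw [e, norm_smul, norm_smul, Real.norm_eq_abs, abs_of_pos (ht k)]
  have := mul_le_mul_of_nonneg_left h2 (ht k).le
  linarith

end ScaledTangentSet

theorem exists_norm_sub_le_of_isClosed {E : Type*} [NormedAddCommGroup E] [ProperSpace E]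
    {S : Set E} (hS : IsClosed S) (hne : S.Nonempty) (p : E) :
    ∃ q ∈ S, ∀ y ∈ S, ‖p - q‖ ≤ ‖p - y‖ := by
  obtain ⟨q, hq, h⟩ := hS.exists_infDist_eq_dist hne p
  refine ⟨q, hq, fun y hy => ?_⟩
  rw [← dist_eq_norm, ← dist_eq_norm, ← h]
  exact Metric.infDist_le_dist_of_mem hy

/-! ### Proximal and directional limiting normals. -/

section Normals

variable {E : Type*} [NormedAddCommGroup E] [InnerProductSpace ℝ E]
  {S : Set E} {x d v : E} {τ : ℝ}

/-- The proximal normal cone. -/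
def proximalNormalCone (S : Set E) (x : E) : Set E :=
  {v | x ∈ S ∧ ∃ σ : ℝ, 0 ≤ σ ∧ ∀ y ∈ S, inner ℝ v (y - x) ≤ σ * ‖y - x‖ ^ 2}

theorem proximalNormalCone_subset_frechetNormalCone :
    proximalNormalCone S x ⊆ frechetNormalCone S x := by
  rintro v ⟨hx, σ, hσ, h⟩
  refine ⟨hx, fun ε hε => ?_⟩
  have hball : ∀ᶠ y in 𝓝[S] x, dist y x < ε / (σ + 1) :=
    eventually_nhdsWithin_of_eventually_nhds (Metric.ball_mem_nhds x (by positivity))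
  filter_upwards [self_mem_nhdsWithin, hball] with y hy hd
  rw [dist_eq_norm, lt_div_iff₀ (by positivity)] at hd
  have h0 := norm_nonneg (y - x)
  calc inner ℝ v (y - x) ≤ σ * ‖y - x‖ ^ 2 := h y hy
    _ = (σ * ‖y - x‖) * ‖y - x‖ := by ring
    _ ≤ ε * ‖y - x‖ := by gcongr; linarith

theorem smul_mem_proximalNormalCone {c : ℝ} (hc : 0 ≤ c) (hv : v ∈ proximalNormalCone S x) :
    c • v ∈ proximalNormalCone S x := by
  obtain ⟨hx, σ, hσ, h⟩ := hv
  refine ⟨hx, c * σ, by positivity, fun y hy => ?_⟩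
  rw [real_inner_smul_left, mul_assoc]
  exact mul_le_mul_of_nonneg_left (h y hy) hc

theorem sub_mem_proximalNormalCone {p : E} (hx : x ∈ S) (h : ∀ y ∈ S, ‖p - x‖ ≤ ‖p - y‖) :
    p - x ∈ proximalNormalCone S x := by
  refine ⟨hx, 1 / 2, by norm_num, fun y hy => ?_⟩
  have h1 := norm_sub_sq_real (p - x) (y - x)
  rw [sub_sub_sub_cancel_right] at h1
  have h2 := pow_le_pow_left₀ (norm_nonneg _) (h y hy) 2
  linarith

/-- Expanding the square gives `c ‖y - x‖² ≤ 2 σ ‖y - x‖²` for any competitor `y`, so `c > 2 σ`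
forces `y = x`. Uniqueness later identifies cluster points of approximate projections. -/
theorem exists_unique_projection_of_mem_proximalNormalCone (hv : v ∈ proximalNormalCone S x) :
    ∃ c : ℝ, 0 < c ∧ ∀ y ∈ S, ‖x + c⁻¹ • v - y‖ ≤ ‖x + c⁻¹ • v - x‖ → y = x := by
  obtain ⟨hx, σ, hσ, h⟩ := hv
  refine ⟨2 * σ + 1, by positivity, fun y hy hle => ?_⟩
  set c := 2 * σ + 1
  have hc : 0 < c := by positivity
  have h1 := norm_sub_sq_real (c⁻¹ • v) (y - x)
  have e1 : c⁻¹ • v - (y - x) = x + c⁻¹ • v - y := by abel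
  rw [e1, real_inner_smul_left] at h1
  rw [add_sub_cancel_left] at hle
  have h2 := pow_le_pow_left₀ (norm_nonneg _) hle 2
  have h3 : ‖y - x‖ ^ 2 ≤ 2 * (c⁻¹ * inner ℝ v (y - x)) := by linarith
  have h4 : c * ‖y - x‖ ^ 2 ≤ 2 * inner ℝ v (y - x) := by
    have := mul_le_mul_of_nonneg_left h3 hc.le
    have e : c * (2 * (c⁻¹ * inner ℝ v (y - x))) = 2 * inner ℝ v (y - x) := by field_simp
    linarith
  have h5 := h y hy
  have h6 : ‖y - x‖ ^ 2 ≤ 0 := by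
    have : c * ‖y - x‖ ^ 2 = 2 * (σ * ‖y - x‖ ^ 2) + ‖y - x‖ ^ 2 := by ring
    linarith
  have h7 : ‖y - x‖ = 0 := by
    have := sq_nonneg ‖y - x‖
    exact pow_eq_zero_iff two_ne_zero |>.1 (le_antisymm h6 this)
  exact sub_eq_zero.1 (norm_eq_zero.1 h7)

theorem mem_directionalNormalCone_iff : v ∈ directionalNormalCone S x d ↔
    ∀ ε : ℝ, 0 < ε → ∃ (t : ℝ) (d' v' : E), 0 < t ∧ t < ε ∧ dist d' d < ε ∧ dist v' v < ε ∧
      v' ∈ frechetNormalCone S (x + t • d') := by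
  constructor
  · rintro ⟨t, d', v', h1, h2, h3, h4, h5⟩ ε hε
    obtain ⟨k, ⟨hk1, hk2⟩, hk3⟩ := ((h2.eventually_lt_const hε).and
      (Metric.tendsto_nhds.1 h3 ε hε)).and (Metric.tendsto_nhds.1 h4 ε hε) |>.exists
    exact ⟨t k, d' k, v' k, h1 k, hk1, hk2, hk3, h5 k⟩
  · intro h
    choose t d' v' h1 h2 h3 h4 h5 using fun k : ℕ =>
      h (1 / ((k : ℝ) + 1)) Nat.one_div_pos_of_nat
    exact ⟨t, d', v', h1, tendsto_of_dist_lt_one_div fun k => by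
      simpa [abs_of_pos (h1 k)] using h2 k, tendsto_of_dist_lt_one_div h3,
      tendsto_of_dist_lt_one_div h4, h5⟩

theorem isClosed_directionalNormalCone : IsClosed (directionalNormalCone S x d) := by
  refine isClosed_of_closure_subset fun v hv => mem_directionalNormalCone_iff.2 fun ε hε => ?_
  obtain ⟨u, hu, huv⟩ := Metric.mem_closure_iff.1 hv (ε / 2) (half_pos hε)
  obtain ⟨t, d', v', h1, h2, h3, h4, h5⟩ :=
    mem_directionalNormalCone_iff.1 hu (ε / 2) (half_pos hε)
  refine ⟨t, d', v', h1, by linarith, by linarith, ?_, h5⟩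
  have := dist_triangle v' u v
  rw [dist_comm u v] at this
  linarith

/-- Proximal normals to a scaled tangent set are directional limiting normals to the set. -/
theorem proximalNormalCone_scaledTangentSet_subset [ProperSpace E] (hS : IsClosed S) {u : E} :
    proximalNormalCone (scaledTangentSet τ S x d) u ⊆ directionalNormalCone S x d := by
  intro v hv
  obtain ⟨c, hc, huniq⟩ := exists_unique_projection_of_mem_proximalNormalCone hv
  obtain ⟨t, s, u', ht, hs, ht0, hst, hτ, hu', hmem⟩ := mem_scaledTangentSet_iff.1 hv.1
  set p := u + c⁻¹ • v with hp
  -- Project `x + t d + s p` onto `S` and rescale; the projections `q k` stay bounded because `u' k`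
  -- is a competitor.
  have hproj : ∀ k, ∃ q : E, x + (t k • d + s k • q) ∈ S ∧
      ∀ y ∈ S, ‖x + (t k • d + s k • p) - (x + (t k • d + s k • q))‖ ≤
        ‖x + (t k • d + s k • p) - y‖ := by
    intro k
    obtain ⟨q, hq, hmin⟩ := exists_norm_sub_le_of_isClosed hS ⟨_, hmem k⟩
      (x + (t k • d + s k • p))
    have e : x + (t k • d + s k • ((s k)⁻¹ • (q - x - t k • d))) = q := by
      rw [smul_inv_smul₀ (hs k).ne']
      abel
    exact ⟨(s k)⁻¹ • (q - x - t k • d), by rwa [e], by rwa [e]⟩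
  choose q hqS hqmin using hproj
  have hdiff : ∀ k (z : E), x + (t k • d + s k • p) - (x + (t k • d + s k • z))
      = s k • (p - z) := fun k z => by module
  have hqle : ∀ k, ‖p - q k‖ ≤ ‖p - u' k‖ := fun k => by
    have := hqmin k _ (hmem k)
    rw [hdiff, hdiff, norm_smul, norm_smul] at this
    exact le_of_mul_le_mul_left this (norm_pos_iff.2 (hs k).ne')
  have hpu : Tendsto (fun k => ‖p - u' k‖) atTop (𝓝 ‖p - u‖) := (hu'.const_sub p).norm
  obtain ⟨R, hR⟩ := hpu.bddAbove_range
  have hqb : ∀ k, q k ∈ Metric.closedBall p R := fun k => by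
    rw [Metric.mem_closedBall, dist_comm, dist_eq_norm]
    exact (hqle k).trans (hR ⟨k, rfl⟩)
  obtain ⟨a, -, φ, hφ, ha⟩ := (isCompact_closedBall p R).tendsto_subseq hqb
  have haT : a ∈ scaledTangentSet τ S x d :=
    mem_scaledTangentSet_of_subseq hφ (.of_forall ht) (.of_forall hs) ht0 hst hτ ha
      (.of_forall hqS)
  -- The cluster point lies in the tangent set and is no farther from `p` than `u`, so it is `u`;
  -- hence `c • (p - q)` tends to `v` along the subsequence.
  have hau : a = u := huniq a haT <|
    le_of_tendsto_of_tendsto' (ha.const_sub p).norm (hpu.comp hφ.tendsto_atTop)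
      fun k => hqle (φ k)
  subst hau
  refine ⟨t ∘ φ, fun k => d + (s (φ k) / t (φ k)) • q (φ k), fun k => c • (p - q (φ k)),
    fun k => ht _, ht0.comp hφ.tendsto_atTop,
    tendsto_direction (hst.comp hφ.tendsto_atTop) ha, ?_, fun k => ?_⟩
  · have := (ha.const_sub p).const_smul c
    rwa [hp, add_sub_cancel_left, smul_inv_smul₀ hc.ne'] at this
  · simp only [Function.comp]
    rw [smul_direction (ht _)]
    refine proximalNormalCone_subset_frechetNormalCone ?_
    have h1 := smul_mem_proximalNormalCone (c := c * (s (φ k))⁻¹)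
      (mul_nonneg hc.le (inv_nonneg.2 (hs _).le))
      (sub_mem_proximalNormalCone (hqS (φ k)) (hqmin (φ k)))
    rwa [hdiff, mul_smul, inv_smul_smul₀ (hs _).ne'] at h1

end Normals

/-! ### Consequences of MSCQ and of local optimality for tangent sets. -/

theorem MSCQInDirection.exists_norm_sub_le {E F : Type*} [NormedAddCommGroup E]
    [InnerProductSpace ℝ E] [ProperSpace E] [NormedAddCommGroup F] {g : E → F} {K : Set F}
    {x d : E} (hg : Continuous g)
    (hK : IsClosed K) (hx : x ∈ g ⁻¹' K) (h : MSCQInDirection g K x d) :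
    ∃ ρ δ κ : ℝ, 0 < ρ ∧ 0 < δ ∧ 0 < κ ∧ ∀ w ∈ directionalNhd ρ δ d, ∀ y ∈ K,
      ∃ z ∈ g ⁻¹' K, ‖x + w - z‖ ≤ κ * ‖g (x + w) - y‖ := by
  obtain ⟨ρ, δ, κ, hρ, hδ, hκ, H⟩ := h
  refine ⟨ρ, δ, κ, hρ, hδ, hκ, fun w hw y hy => ?_⟩
  have hset : {z | (0 : F) ∈ (fun y => g z - y) '' K} = g ⁻¹' K := by
    ext z
    simp [sub_eq_zero]
  have h1 := H w hw
  simp only [hset] at h1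
  obtain ⟨z, hz, hdist⟩ := (hK.preimage hg).exists_infDist_eq_dist ⟨x, hx⟩ (x + w)
  refine ⟨z, hz, ?_⟩
  have h2 : Metric.infEDist (0 : F) ((fun y => g (x + w) - y) '' K) ≤
      ENNReal.ofReal ‖g (x + w) - y‖ := by
    refine (Metric.infEDist_le_edist_of_mem (Set.mem_image_of_mem _ hy)).trans ?_
    rw [edist_dist, dist_zero_left]
  have h3 : Metric.infEDist (x + w) (g ⁻¹' K) ≤ ENNReal.ofReal (κ * ‖g (x + w) - y‖) := by
    rw [ENNReal.ofReal_mul hκ.le]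
    exact h1.trans (by gcongr)
  rw [← dist_eq_norm, ← hdist, Metric.infDist]
  exact ENNReal.toReal_le_of_le_ofReal (by positivity) h3

section Constraint

variable {E F : Type*} [NormedAddCommGroup E] [InnerProductSpace ℝ E]
  [NormedAddCommGroup F] [InnerProductSpace ℝ F] {g : E → F} {K : Set F} {x d : E} {τ : ℝ}

/-- The linearized image of a tangent vector to `g⁻¹(K)` is tangent to `K`. -/
theorem fderiv_add_mem_scaledTangentSet (hg : ContDiff ℝ 2 g) {w : E}
    (hw : w ∈ scaledTangentSet τ (g ⁻¹' K) x d) :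
    fderiv ℝ g x w + τ • fderiv ℝ (fderiv ℝ g) x d d ∈
      scaledTangentSet τ K (g x) (fderiv ℝ g x d) := by
  obtain ⟨t, s, w', ht, hs, ht0, hst, hτ, hw', hmem⟩ := mem_scaledTangentSet_iff.1 hw
  refine mem_scaledTangentSet_iff.2 ⟨t, s, _, ht, hs, ht0, hst, hτ,
    tendsto_taylor_two hg ht hs ht0 hst hτ hw', fun k => ?_⟩
  rw [smul_inv_smul₀ (hs k).ne']
  convert hmem k using 1
  rw [Set.mem_preimage]
  congr! 1
  abel

/-- Under MSCQ, an error bound holds for the linearized second-order tangent system. -/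
theorem MSCQInDirection.exists_mem_scaledTangentSet [ProperSpace E] (hg : ContDiff ℝ 2 g)
    (hK : IsClosed K) (hx : x ∈ g ⁻¹' K) (h : MSCQInDirection g K x d) :
    ∃ κ : ℝ, 0 < κ ∧ ∀ (w : E), ∀ u ∈ scaledTangentSet τ K (g x) (fderiv ℝ g x d),
      ∃ z ∈ scaledTangentSet τ (g ⁻¹' K) x d,
        ‖w - z‖ ≤ κ * ‖fderiv ℝ g x w + τ • fderiv ℝ (fderiv ℝ g) x d d - u‖ := by
  obtain ⟨ρ, δ, κ, hρ, hδ, hκ, H⟩ := h.exists_norm_sub_le hg.continuous hK hx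
  refine ⟨κ, hκ, fun w u hu => ?_⟩
  obtain ⟨t, s, u', ht, hs, ht0, hst, hτ, hu', hmem⟩ := mem_scaledTangentSet_iff.1 hu
  have hT := tendsto_taylor_two (x := x) (d := d) hg ht hs ht0 hst hτ (tendsto_const_nhds (x := w))
  set q : ℕ → F := fun k =>
    (s k)⁻¹ • (g (x + (t k • d + s k • w)) - g x - t k • fderiv ℝ g x d) with hq
  have hnhd := eventually_mem_directionalNhd (d := d) hρ hδ ht ht0 hst
    (tendsto_const_nhds (x := w))
  have hex : ∀ k, ∃ z : E, t k • d + s k • w ∈ directionalNhd ρ δ d →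
      x + (t k • d + s k • z) ∈ g ⁻¹' K ∧ ‖w - z‖ ≤ κ * ‖q k - u' k‖ := by
    intro k
    by_cases hk : t k • d + s k • w ∈ directionalNhd ρ δ d
    · obtain ⟨z, hz, hle⟩ := H _ hk _ (hmem k)
      have e : x + (t k • d + s k • ((s k)⁻¹ • (z - x - t k • d))) = z := by
        rw [smul_inv_smul₀ (hs k).ne']
        abel
      refine ⟨(s k)⁻¹ • (z - x - t k • d), fun _ => ⟨by rwa [e], ?_⟩⟩
      have e1 : x + (t k • d + s k • w) - z =
          s k • (w - (s k)⁻¹ • (z - x - t k • d)) := by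
        rw [smul_sub, smul_inv_smul₀ (hs k).ne']
        abel
      have e2 : g (x + (t k • d + s k • w)) - (g x + (t k • fderiv ℝ g x d + s k • u' k)) =
          s k • (q k - u' k) := by
        rw [hq, smul_sub, smul_inv_smul₀ (hs k).ne']
        abel
      rw [e1, e2, norm_smul, norm_smul, mul_left_comm] at hle
      exact le_of_mul_le_mul_left hle (norm_pos_iff.2 (hs k).ne')
    · exact ⟨0, fun h => absurd h hk⟩
  choose z hz using hex
  have hlim : Tendsto (fun k => κ * ‖q k - u' k‖) atTop
      (𝓝 (κ * ‖fderiv ℝ g x w + τ • fderiv ℝ (fderiv ℝ g) x d d - u‖)) :=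
    (hT.sub hu').norm.const_mul κ
  obtain ⟨R, hR⟩ := hlim.bddAbove_range
  have hzb : ∃ᶠ k in atTop, z k ∈ Metric.closedBall w R := by
    refine (hnhd.mono fun k hk => ?_).frequently
    rw [Metric.mem_closedBall, dist_comm, dist_eq_norm]
    exact (hz k hk).2.trans (hR ⟨k, rfl⟩)
  obtain ⟨a, -, φ, hφ, ha⟩ := (isCompact_closedBall w R).tendsto_subseq' hzb
  refine ⟨a, mem_scaledTangentSet_of_subseq hφ (.of_forall ht) (.of_forall hs) ht0 hst hτ ha
    (hnhd.mono fun k hk => (hz k hk).1), ?_⟩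
  exact le_of_tendsto_of_tendsto (ha.const_sub w).norm (hlim.comp hφ.tendsto_atTop)
    ((hφ.tendsto_atTop.eventually hnhd).mono fun k hk => (hz _ hk).2)

/-- Second-order growth along second-order tangents at a directional local minimizer. -/
theorem IsLocalSolutionInDirection.fderiv_add_nonneg {f : E → ℝ} (hf : ContDiff ℝ 2 f)
    {C : Set E} (hx : IsLocalSolutionInDirection f C x d) (hfd : fderiv ℝ f x d = 0) {w : E}
    (hw : w ∈ scaledTangentSet τ C x d) :
    0 ≤ fderiv ℝ f x w + τ * fderiv ℝ (fderiv ℝ f) x d d := by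
  obtain ⟨-, ρ, δ, hρ, hδ, H⟩ := hx
  obtain ⟨t, s, w', ht, hs, ht0, hst, hτ, hw', hmem⟩ := mem_scaledTangentSet_iff.1 hw
  refine ge_of_tendsto (tendsto_taylor_two hf ht hs ht0 hst hτ hw') ?_
  filter_upwards [eventually_mem_directionalNhd (d := d) hρ hδ ht ht0 hst hw'] with k hk
  have := H _ hk (hmem k)
  rw [hfd, smul_zero, sub_zero, smul_eq_mul]
  exact mul_nonneg (inv_nonneg.2 (hs k).le) (sub_nonneg.2 this)

/-- With `r = √t + √‖d' - d‖` both `t` and `‖d' - d‖` are at most `r²`, so `s = t r` and `w' = (d' -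
d) / r` meet all requirements. This is why the asymptotic case needs no nonemptiness hypothesis. -/
theorem zero_mem_scaledTangentSet_zero {C : Set E} (hd : d ∈ tangentCone C x) :
    (0 : E) ∈ scaledTangentSet 0 C x d := by
  obtain ⟨t, d', ht, ht0, hd', hmem⟩ := hd
  set r : ℕ → ℝ := fun k => √(t k) + √‖d' k - d‖ with hr
  have hr0 : Tendsto r atTop (𝓝 0) := by
    have h1 := ht0.sqrt
    have h2 := ((hd'.sub_const d).norm).sqrt
    simpa using h1.add h2
  have hrt : ∀ k, √(t k) ≤ r k := fun k => by simp [hr]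
  have hpos : ∀ k, 0 < r k := fun k => (Real.sqrt_pos.2 (ht k)).trans_le (hrt k)
  have hrd : ∀ k, ‖d' k - d‖ ≤ r k * r k := fun k => by
    have h1 : √‖d' k - d‖ ≤ r k := by simp [hr]
    have h2 := mul_self_le_mul_self (Real.sqrt_nonneg _) h1
    rwa [Real.mul_self_sqrt (norm_nonneg _)] at h2
  have hrt' : ∀ k, t k ≤ r k * r k := fun k => by
    have h2 := mul_self_le_mul_self (Real.sqrt_nonneg _) (hrt k)
    rwa [Real.mul_self_sqrt (ht k).le] at h2
  refine mem_scaledTangentSet_iff.2 ⟨t, fun k => t k * r k, fun k => (r k)⁻¹ • (d' k - d), ht,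
    fun k => mul_pos (ht k) (hpos k), ht0, ?_, ?_, ?_, fun k => ?_⟩
  · refine hr0.congr fun k => ?_
    have := (ht k).ne'
    field_simp
  · refine squeeze_zero (fun k => ?_) (fun k => ?_) hr0
    · have := ht k
      have := hpos k
      positivity
    · have := ht k
      have := hpos k
      rw [div_le_iff₀ (by positivity)]
      have := mul_le_mul_of_nonneg_left (hrt' k) (ht k).le
      nlinarith [mul_pos (ht k) (mul_pos (hpos k) (hpos k))]
  · refine tendsto_zero_iff_norm_tendsto_zero.2
      (squeeze_zero (fun _ => norm_nonneg _) (fun k => ?_) hr0)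
    rw [norm_smul, norm_inv, Real.norm_eq_abs, abs_of_pos (hpos k), inv_mul_le_iff₀ (hpos k)]
    exact hrd k
  · rw [mul_smul, smul_inv_smul₀ (hpos k).ne', ← smul_add, add_sub_cancel]
    exact hmem k

end Constraint

/-- Testing `s = -L / (Q + 1)` gives `-L² / (Q + 1)²`, and also covers `Q = 0`. -/
theorem eq_zero_of_forall_nonneg_quadratic {L Q : ℝ} (hQ : 0 ≤ Q)
    (h : ∀ s : ℝ, 0 ≤ s * L + s ^ 2 * Q) : L = 0 := by
  have h1 := h (-L / (Q + 1))
  have hQ1 : 0 < Q + 1 := by linarith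
  have e : -L / (Q + 1) * L + (-L / (Q + 1)) ^ 2 * Q = -(L ^ 2 / (Q + 1) ^ 2) := by
    field_simp
    ring
  rw [e] at h1
  have h2 : L ^ 2 / (Q + 1) ^ 2 = 0 := le_antisymm (by linarith) (by positivity)
  rcases div_eq_zero_iff.1 h2 with h3 | h3
  · exact pow_eq_zero_iff two_ne_zero |>.1 h3
  · exact absurd h3 (by positivity)

/-! ### Comparison of the support functions. -/

section Support

variable {E : Type*} [NormedAddCommGroup E] [InnerProductSpace ℝ E]

theorem lowerSupportFunOn_anti (S : Set E) {A B : Set E} (hAB : A ⊆ B) (l : E) :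
    lowerSupportFunOn S B l ≤ lowerSupportFunOn S A l := by
  unfold lowerSupportFunOn
  split_ifs
  · exact le_rfl
  · exact liminf_le_liminf (.of_forall fun l' =>
      biInf_mono fun u hu => ⟨hu.1, hAB hu.2⟩)

/-- Each `u k` is admissible in the infimum at `l' k`, and its value exceeds `⟪l, u k⟫` by at most a
null sequence. The `u k` themselves need not converge or stay bounded. -/
theorem lowerSupportFunOn_le_supportFun {S T : Set E} (hT : T.Nonempty) {l b : E}
    {l' u : ℕ → E} (hl : Tendsto l' atTop (𝓝 l)) (hu : ∀ k, u k ∈ S)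
    (hN : ∀ k, l' k ∈ limitingNormalCone T (u k))
    (hle : ∀ k, inner ℝ (l' k) (u k) ≤ inner ℝ l (u k) + inner ℝ (l' k - l) b) :
    lowerSupportFunOn T S l ≤ supportFun S l := by
  rw [lowerSupportFunOn, if_neg hT.ne_empty]
  refine le_of_forall_gt_imp_ge_of_dense fun r hr => ?_
  obtain ⟨q, hq, hqr⟩ := EReal.lt_iff_exists_real_btwn.1 hr
  obtain ⟨p, hp, hpq⟩ := EReal.lt_iff_exists_real_btwn.1 hq
  have hpq' : p < q := EReal.coe_lt_coe_iff.1 hpq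
  have hsup : ∀ k, inner ℝ l (u k) < p := fun k => by
    rw [← EReal.coe_lt_coe_iff]
    exact (le_iSup₂ (f := fun u (_ : u ∈ S) => ((inner ℝ l u : ℝ) : EReal)) (u k) (hu k)).trans_lt
      hp
  have h0 : Tendsto (fun k => inner ℝ (l' k - l) b) atTop (𝓝 0) := by
    simpa using (hl.sub_const l).inner (tendsto_const_nhds (x := b))
  refine liminf_le_of_frequently_le' (hl.frequently (Eventually.frequently ?_))
  filter_upwards [h0.eventually_lt_const (sub_pos.2 hpq')] with k hk
  refine (iInf₂_le (u k) ⟨hN k, hu k⟩).trans (le_trans ?_ hqr.le)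
  rw [EReal.coe_le_coe_iff]
  linarith [hle k, hsup k]

end Support

/-! ### Multipliers by penalization and regularization. -/

section Multipliers

variable {E F : Type*} [NormedAddCommGroup E] [InnerProductSpace ℝ E] [ProperSpace E]
  [NormedAddCommGroup F] [InnerProductSpace ℝ F] [ProperSpace F]
  {T : Set F} {A : E →L[ℝ] F} {a : E →L[ℝ] ℝ} {b : F} {ε κ : ℝ}

/-- Minimizers of the quadratic penalization of `min a z + ε ‖z‖²` subject to `A z + b ∈ T`. -/
theorem exists_quadratic_penalty (hT : IsClosed T) (hb : b ∈ T) (hε : 0 ≤ ε) (hκ : 0 < κ)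
    (heb : ∀ z, ∀ u ∈ T, ∃ z', A z' + b ∈ T ∧ ‖z - z'‖ ≤ κ * ‖A z + b - u‖)
    (hmin : ∀ z, A z + b ∈ T → 0 ≤ a z + ε * ‖z‖ ^ 2) {c : ℝ} (hc : 0 < c)
    (hcε : 4 * ε * κ ^ 2 ≤ c) :
    ∃ z u, c * ‖A z + b - u‖ ≤ 2 * κ * ‖a‖ ∧ c * ‖z‖ ^ 2 ≤ 2 * κ ^ 2 * ‖a‖ ^ 2 ∧
      (2 * c) • (A z + b - u) ∈ proximalNormalCone T u ∧
      ∀ v, a v + 2 * (2 * ε + 1) * inner ℝ z v + inner ℝ ((2 * c) • (A z + b - u)) (A v) = 0 := by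
  -- The coefficient `2 * ε` pays for `‖z'‖² ≤ 2 (‖z‖² + κ² e²)` when passing to a nearby feasible
  -- `z'`; the extra `1` forces the minimizers to `0` as `c` grows. The leftover `2 ε κ² e²` is
  -- absorbed by half of `c e²`.
  set Φ : E → ℝ := fun z => a z + (2 * ε + 1) * ‖z‖ ^ 2 + c * Metric.infDist (A z + b) T ^ 2
    with hΦ
  have hΦc : Continuous Φ := by
    have : Continuous fun z => Metric.infDist (A z + b) T :=
      (Metric.continuous_infDist_pt T).comp (by fun_prop)
    fun_prop
  have hab : ∀ z, -(‖a‖ * ‖z‖) ≤ a z := fun z =>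
    neg_le_of_abs_le ((Real.norm_eq_abs _).symm.le.trans (a.le_opNorm z))
  have hΦ0 : Φ 0 = 0 := by simp [hΦ, Metric.infDist_zero_of_mem hb]
  obtain ⟨z, hz⟩ := hΦc.exists_forall_le' 0 <| by
    filter_upwards [(tendsto_norm_cocompact_atTop (E := E)).eventually_ge_atTop ‖a‖] with z hz
    rw [hΦ0]
    have h1 := hab z
    have h2 := mul_nonneg (norm_nonneg z) (sub_nonneg.2 hz)
    have h3 := mul_nonneg hε (sq_nonneg ‖z‖)
    have h4 := mul_nonneg hc.le (sq_nonneg (Metric.infDist (A z + b) T))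
    simp only [hΦ]
    nlinarith
  obtain ⟨u, hu, hmu⟩ := exists_norm_sub_le_of_isClosed hT ⟨b, hb⟩ (A z + b)
  set e := ‖A z + b - u‖ with he
  have he0 : 0 ≤ e := norm_nonneg _
  have hinf : Metric.infDist (A z + b) T = e := by
    refine le_antisymm ?_ ?_
    · rw [he, ← dist_eq_norm]
      exact Metric.infDist_le_dist_of_mem hu
    · refine (Metric.le_infDist ⟨b, hb⟩).2 fun y hy => ?_
      rw [dist_eq_norm]
      exact hmu y hy
  have hΦz : Φ z = a z + (2 * ε + 1) * ‖z‖ ^ 2 + c * e ^ 2 := by rw [hΦ, ← hinf]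
  have hle0 : a z + (2 * ε + 1) * ‖z‖ ^ 2 + c * e ^ 2 ≤ 0 := by
    rw [← hΦz, ← hΦ0]
    exact hz 0
  have hmain : ‖z‖ ^ 2 + c / 2 * e ^ 2 ≤ ‖a‖ * κ * e := by
    obtain ⟨z', hz', hzz'⟩ := heb z u hu
    have h1 := hmin z' hz'
    have h2 : a z' ≤ a z + ‖a‖ * (κ * e) := by
      have h3 := hab (z - z')
      rw [map_sub] at h3
      have h4 : ‖a‖ * ‖z - z'‖ ≤ ‖a‖ * (κ * e) := by gcongr
      linarith
    have h5 : ‖z'‖ ^ 2 ≤ 2 * (‖z‖ ^ 2 + κ ^ 2 * e ^ 2) := by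
      have h6 : ‖z'‖ ≤ ‖z‖ + κ * e := by
        have := norm_sub_norm_le z' z
        rw [norm_sub_rev] at this
        linarith
      have h7 := pow_le_pow_left₀ (norm_nonneg _) h6 2
      nlinarith [sq_nonneg (‖z‖ - κ * e)]
    have h8 := mul_le_mul_of_nonneg_left h5 hε
    have h9 := mul_le_mul_of_nonneg_right hcε (sq_nonneg e)
    nlinarith
  have hce : c * e ≤ 2 * κ * ‖a‖ := by
    rcases he0.eq_or_lt with h0 | h0
    · rw [← h0, mul_zero]
      positivity
    · have h1 : c / 2 * e * e ≤ ‖a‖ * κ * e := by nlinarith [sq_nonneg ‖z‖]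
      have := le_of_mul_le_mul_right h1 h0
      linarith
  refine ⟨z, u, hce, ?_, smul_mem_proximalNormalCone (by positivity)
    (sub_mem_proximalNormalCone hu hmu), fun v => ?_⟩
  · have h1 : ‖z‖ ^ 2 ≤ ‖a‖ * κ * e := by
      have : 0 ≤ c / 2 * e ^ 2 := by positivity
      linarith
    calc c * ‖z‖ ^ 2 ≤ c * (‖a‖ * κ * e) := by gcongr
      _ = ‖a‖ * κ * (c * e) := by ring
      _ ≤ ‖a‖ * κ * (2 * κ * ‖a‖) := by gcongr
      _ = 2 * κ ^ 2 * ‖a‖ ^ 2 := by ring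
  -- Replacing the distance to `T` by the distance to the fixed projection `u` majorizes `Φ` by a
  -- quadratic that agrees with it at `z`, so no differentiability of the distance is needed.
  · refine eq_zero_of_forall_nonneg_quadratic
      (Q := (2 * ε + 1) * ‖v‖ ^ 2 + c * ‖A v‖ ^ 2) (by positivity) fun s => ?_
    have h1 := hz (z + s • v)
    have h2 : Φ (z + s • v) ≤ a (z + s • v) + (2 * ε + 1) * ‖z + s • v‖ ^ 2 +
        c * ‖A z + b - u + s • A v‖ ^ 2 := by
      have h3 : Metric.infDist (A (z + s • v) + b) T ≤ ‖A z + b - u + s • A v‖ := by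
        refine (Metric.infDist_le_dist_of_mem hu).trans_eq ?_
        rw [dist_eq_norm, map_add, map_smul]
        congr 1
        abel
      have := pow_le_pow_left₀ Metric.infDist_nonneg h3 2
      simp only [hΦ]
      gcongr
    rw [hΦz] at h1
    have h4 := h1.trans h2
    rw [norm_add_sq_real, norm_add_sq_real, real_inner_smul_right, real_inner_smul_right,
      norm_smul, norm_smul, mul_pow, mul_pow, Real.norm_eq_abs, sq_abs, map_add, map_smul,
      smul_eq_mul, ← he] at h4
    rw [real_inner_smul_left]
    linarith

/-- Lagrange multipliers for `min a z + ε ‖z‖²` subject to `A z + b ∈ T`, at the solution `0`. -/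
theorem exists_multiplier_tendsto (hT : IsClosed T) (hb : b ∈ T) (hε : 0 ≤ ε) (hκ : 0 < κ)
    (heb : ∀ z, ∀ u ∈ T, ∃ z', A z' + b ∈ T ∧ ‖z - z'‖ ≤ κ * ‖A z + b - u‖)
    (hmin : ∀ z, A z + b ∈ T → 0 ≤ a z + ε * ‖z‖ ^ 2) :
    ∃ l : F, ‖l‖ ≤ 4 * κ * ‖a‖ ∧ (∀ v, a v + inner ℝ l (A v) = 0) ∧
      ∃ u' l' : ℕ → F, Tendsto u' atTop (𝓝 b) ∧ Tendsto l' atTop (𝓝 l) ∧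
        ∀ k, l' k ∈ proximalNormalCone T (u' k) := by
  set c : ℕ → ℝ := fun k => 4 * ε * κ ^ 2 + (k + 1) with hcdef
  have hc : ∀ k, 0 < c k := fun k => by positivity
  have hctop : Tendsto c atTop atTop :=
    tendsto_atTop_add_const_left _ _ (tendsto_atTop_add_const_right _ _
      tendsto_natCast_atTop_atTop)
  choose z u h1 h2 h3 h4 using fun k => exists_quadratic_penalty hT hb hε hκ heb hmin (hc k)
    (show 4 * ε * κ ^ 2 ≤ c k from le_add_of_nonneg_right (by positivity))
  set l' : ℕ → F := fun k => (2 * c k) • (A (z k) + b - u k) with hl'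
  -- The bound involves neither `ε` nor `b`, so it is uniform over the regularized problems.
  have hlb : ∀ k, l' k ∈ Metric.closedBall (0 : F) (4 * κ * ‖a‖) := fun k => by
    rw [mem_closedBall_zero_iff, norm_smul, Real.norm_eq_abs,
      abs_of_pos (mul_pos two_pos (hc k))]
    linarith [h1 k]
  have hz : Tendsto z atTop (𝓝 0) := by
    have hsq : Tendsto (fun k => ‖z k‖ ^ 2) atTop (𝓝 0) :=
      squeeze_zero (fun _ => by positivity) (fun k => (le_div_iff₀' (hc k)).2 (h2 k))
        (hctop.const_div_atTop _)
    have := hsq.sqrt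
    simp only [Real.sqrt_zero, Real.sqrt_sq (norm_nonneg _)] at this
    exact tendsto_zero_iff_norm_tendsto_zero.2 this
  have hr : Tendsto (fun k => A (z k) + b - u k) atTop (𝓝 0) :=
    tendsto_zero_iff_norm_tendsto_zero.2 <|
      squeeze_zero (fun _ => norm_nonneg _) (fun k => (le_div_iff₀' (hc k)).2 (h1 k))
        (hctop.const_div_atTop _)
  have hu : Tendsto u atTop (𝓝 b) := by
    have := (((A.continuous.tendsto 0).comp hz).add_const b).sub hr
    simpa using this
  obtain ⟨l, hl, φ, hφ, hlim⟩ := (isCompact_closedBall (0 : F) _).tendsto_subseq hlb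
  refine ⟨l, mem_closedBall_zero_iff.1 hl, fun v => ?_, u ∘ φ, l' ∘ φ,
    hu.comp hφ.tendsto_atTop, hlim, fun k => h3 _⟩
  have hz' : Tendsto (fun k => inner ℝ (z (φ k)) v) atTop (𝓝 (inner ℝ 0 v)) :=
    (hz.comp hφ.tendsto_atTop).inner tendsto_const_nhds
  have hl2 : Tendsto (fun k => inner ℝ (l' (φ k)) (A v)) atTop (𝓝 (inner ℝ l (A v))) :=
    hlim.inner tendsto_const_nhds
  have := ((hz'.const_mul (2 * (2 * ε + 1))).const_add (a v)).add hl2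
  rw [inner_zero_left, mul_zero, add_zero] at this
  exact tendsto_nhds_unique this (tendsto_const_nhds.congr fun k => (h4 (φ k) v).symm)

/-- A linear program over `{w | A w + b ∈ T}` with finite value, possibly not attained, has a
multiplier at which the lower generalized support function is bounded by the support function. -/
theorem exists_multiplier_lowerSupportFunOn_le (hT : IsClosed T)
    (hne : {w | A w + b ∈ T}.Nonempty) (hκ : 0 < κ)
    (heb : ∀ w, ∀ u ∈ T, ∃ w', A w' + b ∈ T ∧ ‖w - w'‖ ≤ κ * ‖A w + b - u‖)
    {m : ℝ} (hm : ∀ w, A w + b ∈ T → m ≤ a w) {N : Set F} (hN : IsClosed N)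
    (hTN : ∀ u, proximalNormalCone T u ⊆ N) :
    ∃ l ∈ N, (∀ v, a v + inner ℝ l (A v) = 0) ∧
      lowerSupportFunOn T ((fun w => A w + b) '' {w | A w + b ∈ T}) l ≤
        supportFun ((fun w => A w + b) '' {w | A w + b ∈ T}) l := by
  set D := {w | A w + b ∈ T} with hD
  have hDc : IsClosed D := hT.preimage (by fun_prop : Continuous fun w => A w + b)
  obtain ⟨w₀, hw₀⟩ := hne
  have hreg : ∀ ε : ℝ, 0 < ε → ∃ w ∈ D, ∀ y ∈ D, a w + ε * ‖w‖ ^ 2 ≤ a y + ε * ‖y‖ ^ 2 := by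
    intro ε hε
    have hcont : Continuous fun w : E => a w + ε * ‖w‖ ^ 2 := by fun_prop
    refine hcont.continuousOn.exists_isMinOn' hDc hw₀ ?_
    have htop : Tendsto (fun w : E => m + ε * ‖w‖ ^ 2) (cocompact E) atTop :=
      tendsto_atTop_add_const_left _ _ (((tendsto_pow_atTop two_ne_zero).comp
        (tendsto_norm_cocompact_atTop (E := E))).const_mul_atTop hε)
    filter_upwards [(htop.eventually_ge_atTop (a w₀ + ε * ‖w₀‖ ^ 2)).filter_mono inf_le_left,
      mem_inf_of_right (mem_principal_self D)] with w h1 h2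
    exact h1.trans (by gcongr; exact hm w h2)
  set e : ℕ → ℝ := fun k => 1 / ((k : ℝ) + 1) with he
  have he0 : ∀ k, 0 < e k := fun k => Nat.one_div_pos_of_nat
  have he1 : ∀ k, e k ≤ 1 := fun k => by
    rw [he, div_le_one (by positivity)]
    simp
  have helim : Tendsto e atTop (𝓝 0) := tendsto_one_div_add_atTop_nhds_zero_nat
  choose w hwD hwmin using fun k => hreg (e k) (he0 k)
  have hbd : ∀ k, e k * ‖w k‖ ^ 2 ≤ a w₀ + ‖w₀‖ ^ 2 - m := fun k => by
    have h1 := hwmin k w₀ hw₀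
    have h2 := hm _ (hwD k)
    have h3 := mul_le_mul_of_nonneg_right (he1 k) (sq_nonneg ‖w₀‖)
    linarith
  -- `‖e w‖² = e (e ‖w‖²)` and `e ‖w‖²` is bounded, although `w` may be unbounded.
  have hew : Tendsto (fun k => e k • w k) atTop (𝓝 0) := by
    have hsq : Tendsto (fun k => ‖e k • w k‖ ^ 2) atTop (𝓝 0) := by
      refine squeeze_zero (fun _ => by positivity) (fun k => ?_)
        (by simpa using helim.mul_const (a w₀ + ‖w₀‖ ^ 2 - m))
      rw [norm_smul, mul_pow, Real.norm_eq_abs, sq_abs, sq, mul_assoc]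
      exact mul_le_mul_of_nonneg_left (hbd k) (he0 k).le
    have := hsq.sqrt
    simp only [Real.sqrt_zero, Real.sqrt_sq (norm_nonneg _)] at this
    exact tendsto_zero_iff_norm_tendsto_zero.2 this
  -- Derivative at `w k` of the regularized objective; translating by `w k` moves its minimizer to
  -- `0`.
  set a' : ℕ → E →L[ℝ] ℝ := fun k => a + (2 : ℝ) • innerSL ℝ (e k • w k) with ha'
  have ha'v : ∀ k v, a' k v = a v + 2 * (e k * inner ℝ (w k) v) := fun k v => by
    simp [ha']
  have ha'lim : Tendsto a' atTop (𝓝 a) := by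
    have := ((((innerSL ℝ (E := E)).continuous.tendsto 0).comp hew).const_smul (2 : ℝ)).const_add a
    simpa [ha'] using this
  have hmult : ∀ k, ∃ l : F, ‖l‖ ≤ 4 * κ * ‖a' k‖ ∧ (∀ v, a' k v + inner ℝ l (A v) = 0) ∧
      ∃ u' l' : ℕ → F, Tendsto u' atTop (𝓝 (A (w k) + b)) ∧ Tendsto l' atTop (𝓝 l) ∧
        ∀ k, l' k ∈ proximalNormalCone T (u' k) := by
    intro k
    refine exists_multiplier_tendsto hT (hwD k) (he0 k).le hκ (fun z u hu => ?_) (fun z hz => ?_)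
    · obtain ⟨w', hw', hle⟩ := heb (w k + z) u hu
      refine ⟨w' - w k, by rwa [map_sub, ← add_assoc, sub_add_cancel], ?_⟩
      have h1 : z - (w' - w k) = w k + z - w' := by abel
      have h2 : A z + (A (w k) + b) - u = A (w k + z) + b - u := by
        rw [map_add]
        abel
      rwa [h1, h2]
    · have h1 := hwmin k (w k + z) (by
        change A (w k + z) + b ∈ T
        rw [map_add]
        convert hz using 1
        abel)
      rw [norm_add_sq_real, map_add] at h1
      rw [ha'v]
      linarith
  choose l hlb hstat u' l' hu' hl' hprox using hmult
  obtain ⟨R, hR⟩ := (ha'lim.norm.const_mul (4 * κ)).bddAbove_range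
  have hlball : ∀ k, l k ∈ Metric.closedBall (0 : F) R := fun k =>
    mem_closedBall_zero_iff.2 ((hlb k).trans (hR ⟨k, rfl⟩))
  obtain ⟨l₀, -, φ, hφ, hlim⟩ := (isCompact_closedBall (0 : F) R).tendsto_subseq hlball
  have hstat₀ : ∀ v, a v + inner ℝ l₀ (A v) = 0 := fun v => by
    have hav : Tendsto (fun k => a' (φ k) v) atTop (𝓝 (a v)) :=
      (((ContinuousLinearMap.apply ℝ ℝ v).continuous.tendsto a).comp ha'lim).comp
        hφ.tendsto_atTop
    have hlv : Tendsto (fun k => inner ℝ (l (φ k)) (A v)) atTop (𝓝 (inner ℝ l₀ (A v))) :=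
      hlim.inner tendsto_const_nhds
    exact tendsto_nhds_unique (hav.add hlv)
      (tendsto_const_nhds.congr fun k => (hstat (φ k) v).symm)
  refine ⟨l₀, ?_, hstat₀, ?_⟩
  · exact hN.mem_of_tendsto hlim (.of_forall fun k =>
      hN.mem_of_tendsto (hl' (φ k)) (.of_forall fun j => hTN _ (hprox (φ k) j)))
  · refine lowerSupportFunOn_le_supportFun (T := T) (b := b) ⟨A w₀ + b, hw₀⟩ hlim
      (u := fun k => A (w (φ k)) + b) (fun k => ⟨_, hwD _, rfl⟩)
      (fun k => ⟨hwD _, u' (φ k), l' (φ k), hu' _, hl' _, fun j =>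
        proximalNormalCone_subset_frechetNormalCone (hprox _ j)⟩) fun k => ?_
    -- Testing both stationarity equations with `w` itself, the regularization contributes `-2 e
    -- ‖w‖²`, which has the favourable sign.
    have h1 := hstat (φ k) (w (φ k))
    have h2 := hstat₀ (w (φ k))
    rw [ha'v, real_inner_self_eq_norm_sq] at h1
    have h3 : 0 ≤ e (φ k) * ‖w (φ k)‖ ^ 2 := mul_nonneg (he0 _).le (by positivity)
    simp only [Function.comp, inner_add_right, inner_sub_left]
    linarith

end Multipliers

/-! ### Optimality conditions for the original problem. -/

theorem fderiv_lagrangian {E F : Type*} [NormedAddCommGroup E] [InnerProductSpace ℝ E]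
    [NormedAddCommGroup F] [InnerProductSpace ℝ F] {f : E → ℝ} {g : E → F} {x : E}
    (hf : Differentiable ℝ f) (hg : Differentiable ℝ g) (l : F) (v : E) :
    fderiv ℝ (fun z => lagrangian f g z l) x v = fderiv ℝ f x v + inner ℝ l (fderiv ℝ g x v) := by
  have h : HasFDerivAt (fun z => lagrangian f g z l)
      (fderiv ℝ f x + (innerSL ℝ l).comp (fderiv ℝ g x)) x :=
    (hf x).hasFDerivAt.add ((innerSL ℝ l).hasFDerivAt.comp x (hg x).hasFDerivAt)
  rw [h.fderiv]
  simp

section Optimality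

variable {E F : Type*} [NormedAddCommGroup E] [InnerProductSpace ℝ E] [ProperSpace E]
  [NormedAddCommGroup F] [InnerProductSpace ℝ F] [ProperSpace F]
  {f : E → ℝ} {g : E → F} {K : Set F} {x d : E} {τ : ℝ}

/-- Multiplier version of the second-order necessary condition for a scaled tangent set. -/
theorem IsLocalSolutionInDirection.exists_multiplier (hf : ContDiff ℝ 2 f) (hg : ContDiff ℝ 2 g)
    (hK : IsClosed K) (hx : IsLocalSolutionInDirection f (g ⁻¹' K) x d)
    (hfd : fderiv ℝ f x d = 0) (hMS : MSCQInDirection g K x d)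
    (hne : (scaledTangentSet τ K (g x) (fderiv ℝ g x d)).Nonempty) :
    ∃ l ∈ multiplierSet f g K x d,
      lowerSupportFunOn (scaledTangentSet τ K (g x) (fderiv ℝ g x d))
        ((fun w => fderiv ℝ g x w + τ • fderiv ℝ (fderiv ℝ g) x d d) ''
          scaledTangentSet τ (g ⁻¹' K) x d) l ≤
      supportFun ((fun w => fderiv ℝ g x w + τ • fderiv ℝ (fderiv ℝ g) x d d) ''
          scaledTangentSet τ (g ⁻¹' K) x d) l := by
  obtain ⟨κ, hκ, heb⟩ := hMS.exists_mem_scaledTangentSet (τ := τ) hg hK hx.1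
  set T := scaledTangentSet τ K (g x) (fderiv ℝ g x d) with hT
  set b := τ • fderiv ℝ (fderiv ℝ g) x d d with hb
  -- For the reverse inclusion the error bound is applied with zero residual.
  have hD : scaledTangentSet τ (g ⁻¹' K) x d = {w | fderiv ℝ g x w + b ∈ T} := by
    ext w
    refine ⟨fderiv_add_mem_scaledTangentSet hg, fun hw => ?_⟩
    obtain ⟨z, hz, hle⟩ := heb w _ hw
    rw [sub_self, norm_zero, mul_zero] at hle
    rwa [sub_eq_zero.1 (norm_le_zero_iff.1 hle)]
  rw [hD] at heb ⊢
  obtain ⟨u, hu⟩ := hne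
  obtain ⟨z, hz, -⟩ := heb 0 u hu
  obtain ⟨l, hl, hstat, hle⟩ := exists_multiplier_lowerSupportFunOn_le (a := fderiv ℝ f x)
    (m := -(τ * fderiv ℝ (fderiv ℝ f) x d d)) isClosed_scaledTangentSet ⟨z, hz⟩ hκ heb
    (fun w hw => by
      have h : w ∈ scaledTangentSet τ (g ⁻¹' K) x d := by rwa [hD]
      linarith [hx.fderiv_add_nonneg hf hfd h])
    (isClosed_directionalNormalCone (S := K) (x := g x) (d := fderiv ℝ g x d))
    (fun u => proximalNormalCone_scaledTangentSet_subset hK)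
  refine ⟨l, ⟨hl, ?_⟩, hle⟩
  ext v
  rw [fderiv_lagrangian (hf.differentiable (by norm_num)) (hg.differentiable (by norm_num))]
  exact hstat v

end Optimality

end DirOpt

theorem proposition4p6 {n m : ℕ}
    (f : EuclideanSpace ℝ (Fin n) → ℝ)
    (g : EuclideanSpace ℝ (Fin n) → EuclideanSpace ℝ (Fin m))
    (K : Set (EuclideanSpace ℝ (Fin m)))
    (hf : ContDiff ℝ 2 f) (hg : ContDiff ℝ 2 g) (hK : IsClosed K)
    (xbar d : EuclideanSpace ℝ (Fin n))
    (hd : d ∈ DirOpt.tangentCone (g ⁻¹' K) xbar)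
    (hx : DirOpt.IsLocalSolutionInDirection f (g ⁻¹' K) xbar d)
    (hfd : fderiv ℝ f xbar d = 0)
    (hMS : DirOpt.MSCQInDirection g K xbar d) :
    (∃ l ∈ DirOpt.multiplierSet f g K xbar d,
      ∀ A : Set (EuclideanSpace ℝ (Fin m)), DirOpt.thetaSet g K xbar d ⊆ A →
        DirOpt.lowerSupportFun
            (DirOpt.asymptoticTangentCone K (g xbar) (fderiv ℝ g xbar d)) l
          ≤ DirOpt.lowerSupportFunOn
            (DirOpt.asymptoticTangentCone K (g xbar) (fderiv ℝ g xbar d)) A l ∧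
        DirOpt.lowerSupportFunOn
            (DirOpt.asymptoticTangentCone K (g xbar) (fderiv ℝ g xbar d)) A l
          ≤ DirOpt.supportFun (DirOpt.thetaSet g K xbar d) l) ∧
    ((DirOpt.secondTangentSet K (g xbar) (fderiv ℝ g xbar d)).Nonempty →
      ∃ l ∈ DirOpt.multiplierSet f g K xbar d,
        ∀ B : Set (EuclideanSpace ℝ (Fin m)), DirOpt.omegaSet g K xbar d ⊆ B →
          DirOpt.lowerSupportFun
              (DirOpt.secondTangentSet K (g xbar) (fderiv ℝ g xbar d)) l
            ≤ DirOpt.lowerSupportFunOn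
              (DirOpt.secondTangentSet K (g xbar) (fderiv ℝ g xbar d)) B l ∧
          DirOpt.lowerSupportFunOn
              (DirOpt.secondTangentSet K (g xbar) (fderiv ℝ g xbar d)) B l
            ≤ DirOpt.supportFun (DirOpt.omegaSet g K xbar d) l) := by
  simp only [DirOpt.lowerSupportFun, DirOpt.thetaSet, DirOpt.omegaSet,
    DirOpt.asymptoticTangentCone_eq, DirOpt.secondTangentSet_eq]
  constructor
  · have h0 := DirOpt.fderiv_add_mem_scaledTangentSet hg (DirOpt.zero_mem_scaledTangentSet_zero hd)
    obtain ⟨l, hl, hle⟩ := hx.exists_multiplier hf hg hK hfd hMS ⟨_, h0⟩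
    simp only [zero_smul, add_zero] at hle
    -- The multiplier is chosen for `Θ` itself, the smallest admissible set, so it serves every
    -- larger `A` by antitonicity.
    exact ⟨l, hl, fun A hA => ⟨DirOpt.lowerSupportFunOn_anti _ (Set.subset_univ _) l,
      (DirOpt.lowerSupportFunOn_anti _ hA l).trans hle⟩⟩
  · intro hne
    obtain ⟨l, hl, hle⟩ := hx.exists_multiplier hf hg hK hfd hMS hne
    simp only [one_smul] at hle
    exact ⟨l, hl, fun B hB => ⟨DirOpt.lowerSupportFunOn_anti _ (Set.subset_univ _) l,
      (DirOpt.lowerSupportFunOn_anti _ hB l).trans hle⟩⟩
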